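/- Let $K \ge 2$, let $T$ be the horizon, and let $T_1,\dots,T_K$ be integers with $1 \le T_k \le T$. Let $\mathcal E_3(T_1,\dots,T_K)$ be the class of $K$-armed bandit instances in which pulling arm $k$ at epoch $t$ yields a Gaussian reward with variance $1$ and mean $\mu_{k,t}\in[0,1]$, independent of the past given the arm pulled, and in which, for every $k$, the sequence $t\mapsto\mu_{k,t}$ is periodic with minimum period $T_k$. A policy $\pi$ chooses (possibly at random) the arm $\pi_t$ at each epoch $t$ on the basis of the arms pulled and the rewards observed before $t$; it may depend on $K$, $T$ and $T_1,\dots,T_K$. Its expected regret on the instance $\nu$ is $$\mathbb E_\nu[R_T^\pi]=\mathbb E_\nu\Big[\sum_{t=1}^T\Big(\max_{k}\mu_{k,t}-\mu_{\pi_t,t}\Big)\Big].$$ Then every policy $\pi$ satisfies $$\sup_{\nu\in\mathcal E_3(T_1,\dots,T_K)}\mathbb E_\nu[R_T^\pi]\ \ge\ \frac{1}{32e}\sqrt{T\max_{k}T_k}.$$ In particular, the left-hand side is at least $\frac{1}{32e}\cdot\frac{1}{\sqrt K}\sqrt{T\sum_{k=1}^K T_k}$, so that the rate $\sqrt{T\sum_{k}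 T_k}$ cannot be improved by more than a factor of order $\sqrt K$. -/

import Mathlib

open MeasureTheory ProbabilityTheory

noncomputable section

namespace PeriodicBandit

/-- A `K`-armed unit-variance Gaussian bandit instance is given by its mean rewards: `μ k t` is
the mean reward of arm `k` at epoch `t`. Epochs are numbered from `0`, so that a horizon of
length `T` consists of the epochs `0, …, T - 1`. -/
abbrev Means (K : ℕ) : Type := Fin K → ℕ → ℝ

/-- `p` is the minimum period of the sequence `f`: the least positive integer `q` with
`f (t + q) = f t` for all `t`. -/
def IsMinPeriod (f : ℕ → ℝ) (p : ℕ) : Prop :=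
  IsLeast {q : ℕ | 0 < q ∧ ∀ t, f (t + q) = f t} p

/-- The class of bandit instances with mean rewards in `[0, 1]` in which every arm `k` is periodic
with minimum period `τ k`. -/
def periodicClass {K : ℕ} (τ : Fin K → ℕ) : Set (Means K) :=
  {μ | (∀ k t, μ k t ∈ Set.Icc (0 : ℝ) 1) ∧ ∀ k, IsMinPeriod (μ k) (τ k)}

/-- A history of `t` rounds: the arms pulled and the rewards observed. -/
abbrev History (K t : ℕ) : Type := Fin t → Fin K × ℝ

/-- An admissible (possibly randomized) policy: at every epoch `t` it chooses the probability
distribution of the next arm as a measurable function of the arms pulled and the rewards observed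
at the epochs before `t`. -/
structure Policy (K : ℕ) where
  /-- the conditional distribution of the arm pulled at epoch `t` given the history -/
  choice : (t : ℕ) → Kernel (History K t) (Fin K)
  /-- it is a probability distribution -/
  markov : ∀ t, IsMarkovKernel (choice t)

instance {K : ℕ} (π : Policy K) (t : ℕ) : IsMarkovKernel (π.choice t) := π.markov t

/-- The reward distribution at epoch `t`: given the arm `a`, the reward is Gaussian with mean
`μ a t` and variance `1`. -/
def rewardKernel {K : ℕ} (μ : Means K) (t : ℕ) : Kernel (Fin K) ℝ :=
  Kernel.ofFunOfCountable fun a => gaussianReal (μ a t) 1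

instance {K : ℕ} (μ : Means K) (t : ℕ) : IsMarkovKernel (rewardKernel μ t) :=
  ⟨fun a => by
    change IsProbabilityMeasure (gaussianReal (μ a t) 1)
    infer_instance⟩

/-- The joint law of the arm pulled and the reward received at epoch `t`, given the history. The
reward depends on the history only through the arm pulled. -/
def stepKernel {K : ℕ} (π : Policy K) (μ : Means K) (t : ℕ) :
    Kernel (History K t) (Fin K × ℝ) :=
  π.choice t ⊗ₖ Kernel.prodMkLeft (History K t) (rewardKernel μ t)

instance {K : ℕ} (π : Policy K) (μ : Means K) (t : ℕ) : IsMarkovKernel (stepKernel π μ t) := by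
  unfold stepKernel
  infer_instance

/-- Appending the arm and the reward of epoch `t` to the history of the epochs before `t`. -/
def appendRound {K t : ℕ} (x : History K t × (Fin K × ℝ)) : History K (t + 1) :=
  Fin.snoc (α := fun _ => Fin K × ℝ) x.1 x.2

theorem measurable_appendRound {K t : ℕ} :
    Measurable (appendRound : History K t × (Fin K × ℝ) → History K (t + 1)) := by
  refine measurable_pi_lambda _ fun i => ?_
  refine Fin.lastCases ?_ (fun j => ?_) i
  · simpa [appendRound] using measurable_snd
  · simp only [appendRound, Fin.snoc_castSucc]
    exact (measurable_pi_apply j).comp measurable_fst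

/-- The law of the history of the first `t` epochs when the policy `π` interacts with the bandit
instance `μ`. -/
def historyLaw {K : ℕ} (π : Policy K) (μ : Means K) : (t : ℕ) → Measure (History K t)
  | 0 => Measure.dirac Fin.elim0
  | t + 1 => ((historyLaw π μ t) ⊗ₘ (stepKernel π μ t)).map appendRound

instance isProbabilityMeasure_historyLaw {K : ℕ} (π : Policy K) (μ : Means K) (t : ℕ) :
    IsProbabilityMeasure (historyLaw π μ t) := by
  induction t with
  | zero => unfold historyLaw; infer_instance
  | succ t ih =>
    unfold historyLaw
    exact Measure.isProbabilityMeasure_map measurable_appendRound.aemeasurable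

/-- The pseudo-regret of a history of `T` epochs: the sum over the epochs `t < T` of the gap
between the largest mean reward at epoch `t` and the mean reward of the arm pulled. -/
def pseudoRegret {K : ℕ} (μ : Means K) {T : ℕ} (h : History K T) : ℝ :=
  ∑ t : Fin T, ((⨆ k, μ k t) - μ (h t).1 t)

/-- The expected regret of the policy `π` over `T` epochs on the bandit instance `μ`. -/
def expectedRegret {K : ℕ} (π : Policy K) (μ : Means K) (T : ℕ) : ℝ :=
  ∫ h, pseudoRegret μ h ∂(historyLaw π μ T)

/-- The worst-case expected regret of the policy `π` over `T` epochs, i.e. the supremum of its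
expected regret over all bandit instances whose arms have minimum periods `τ`. -/
def worstCaseRegret {K : ℕ} (π : Policy K) (τ : Fin K → ℕ) (T : ℕ) : ℝ :=
  ⨆ μ : periodicClass τ, expectedRegret π μ.1 T

end PeriodicBandit

end

/-!
Let `p` be the largest period, attained by the arm `k₀`. Each of the `p` phases of `k₀` can be
declared, independently of the others, good (`k₀` beats the other arms by about `Δ`) or bad
(`k₀` loses to them by about `Δ`). Switching a single phase changes the mean rewards at no more
than `T / p + 1` epochs, by at most `2 * Δ`, so if `Δ` is of order `√(p / T)` the two history
laws have bounded chi-square divergence. Hence at every epoch of that phase the probabilities of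
a wrong choice on the two instances, whose sets of wrong arms are complementary, add up to at
least `1 / 2`. Averaging over all `2 ^ p` sets of good phases (Assouad's argument) gives an
instance on which the expected number of wrong choices, each costing at least `Δ / 2`, is at
least `T / 4`.
-/

namespace PeriodicBandit

open scoped ENNReal NNReal symmDiff

theorem sqrt_mul_sum_div_sqrt_card_le_sqrt_mul_sup {ι : Type*} [Fintype ι] (f : ι → ℕ) {T : ℝ}
    (hT : 0 ≤ T) :
    Real.sqrt (T * ∑ i, (f i : ℝ)) / Real.sqrt (Fintype.card ι) ≤
      Real.sqrt (T * (Finset.univ.sup f : ℕ)) := by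
  have hsum : ∑ i, (f i : ℝ) ≤ Fintype.card ι * (Finset.univ.sup f : ℕ) := by
    exact_mod_cast Finset.sum_le_card_nsmul _ _ _ fun i hi => Finset.le_sup hi
  refine div_le_of_le_mul₀ (by positivity) (by positivity) ?_
  rw [← Real.sqrt_mul (by positivity)]
  refine Real.sqrt_le_sqrt ?_
  calc T * ∑ i, (f i : ℝ) ≤ T * (Fintype.card ι * (Finset.univ.sup f : ℕ)) := by gcongr
    _ = T * (Finset.univ.sup f : ℕ) * Fintype.card ι := by ring

theorem card_filter_natCast_eq_le (p T : ℕ) [NeZero p] (r : ZMod p) :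
    ((Finset.range T).filter fun t : ℕ => (t : ZMod p) = r).card ≤ T / p + 1 := by
  have h := Nat.count_modEq_card T (NeZero.pos p) r.val
  simp only [Nat.count_eq_card_filter_range, ← ZMod.natCast_eq_natCast_iff, ZMod.natCast_val,
    ZMod.cast_id', id_eq] at h
  rw [h]
  split_ifs <;> omega

theorem exists_card_mul_le_sum_of_perm {Ω ι : Type*} [Finite Ω] [Nonempty Ω] [Fintype ι]
    (σ : ι → Equiv.Perm Ω) {w : Ω → ι → ℝ} {c : ℝ} (h : ∀ ω i, c ≤ w ω i + w (σ i ω) i) :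
    ∃ ω, Fintype.card ι * (c / 2) ≤ ∑ i, w ω i := by
  cases nonempty_fintype Ω
  have average_ge (i : ι) : ∑ _ω : Ω, c / 2 ≤ ∑ ω, w ω i := by
    have hsum := Finset.sum_le_sum fun ω (_ : ω ∈ Finset.univ) => h ω i
    rw [Finset.sum_add_distrib, Equiv.sum_comp (σ i) fun ω => w ω i] at hsum
    rw [← Finset.sum_div]
    linarith
  have total_le : ∑ _ω : Ω, Fintype.card ι * (c / 2) ≤ ∑ ω, ∑ i, w ω i := by
    rw [Finset.sum_comm (f := w)]
    calc ∑ _ω : Ω, Fintype.card ι * (c / 2) = ∑ _i : ι, ∑ _ω : Ω, c / 2 := by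
          simp; ring
      _ ≤ ∑ i, ∑ ω, w ω i := Finset.sum_le_sum fun i _ => average_ge i
  obtain ⟨ω, -, hω⟩ := Finset.exists_le_of_sum_le Finset.univ_nonempty total_le
  exact ⟨ω, hω⟩

/-- `1 + χ²(m ‖ n) ≤ c` for the chi-square divergence, in variational form: this is the form in
which the bound passes to images and to composition products, and it does not mention the density
of `m` with respect to `n`. -/
def ChiSqBound {α : Type*} [MeasurableSpace α] (m n : Measure α) (c : ℝ≥0∞) : Prop :=
  ∀ f : α → ℝ≥0∞, Measurable f → (∫⁻ x, f x ∂m) ^ 2 ≤ c * ∫⁻ x, f x ^ 2 ∂n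

namespace ChiSqBound

variable {α β : Type*} [MeasurableSpace α] [MeasurableSpace β] {m n : Measure α} {c c' : ℝ≥0∞}

theorem mono (h : ChiSqBound m n c) (hc : c ≤ c') : ChiSqBound m n c' :=
  fun f hf => (h f hf).trans (by gcongr)

theorem withDensity (n : Measure α) {r : α → ℝ≥0∞} (hr : Measurable r) :
    ChiSqBound (n.withDensity r) n (∫⁻ x, r x ^ 2 ∂n) := by
  intro f hf
  have hsq (a : ℝ≥0∞) : (a ^ (1 / 2 : ℝ)) ^ 2 = a := by
    rw [← ENNReal.rpow_natCast, ← ENNReal.rpow_mul]; norm_num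
  have holder := ENNReal.lintegral_mul_le_Lp_mul_Lq n Real.HolderConjugate.two_two
    hr.aemeasurable hf.aemeasurable
  calc (∫⁻ x, f x ∂n.withDensity r) ^ 2 = (∫⁻ x, (r * f) x ∂n) ^ 2 := by
        rw [lintegral_withDensity_eq_lintegral_mul n hr hf]
    _ ≤ ((∫⁻ x, r x ^ (2 : ℝ) ∂n) ^ (1 / 2 : ℝ) * (∫⁻ x, f x ^ (2 : ℝ) ∂n) ^ (1 / 2 : ℝ)) ^ 2 := by
        gcongr
    _ = (∫⁻ x, r x ^ 2 ∂n) * ∫⁻ x, f x ^ 2 ∂n := by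
        simp only [mul_pow, hsq, ENNReal.rpow_two]

theorem refl (m : Measure α) [IsProbabilityMeasure m] : ChiSqBound m m 1 := by
  simpa using withDensity m (measurable_one (α := ℝ≥0∞))

theorem map (h : ChiSqBound m n c) {g : α → β} (hg : Measurable g) :
    ChiSqBound (m.map g) (n.map g) c := by
  intro f hf
  rw [lintegral_map hf hg, lintegral_map (hf.pow_const 2) hg]
  exact h _ (hf.comp hg)

theorem compProd [SFinite m] [SFinite n] {κ η : Kernel α β} [IsSFiniteKernel κ]
    [IsSFiniteKernel η] (h : ChiSqBound m n c) (h' : ∀ x, ChiSqBound (κ x) (η x) c') :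
    ChiSqBound (m ⊗ₘ κ) (n ⊗ₘ η) (c * c') := by
  intro f hf
  calc (∫⁻ z, f z ∂(m ⊗ₘ κ)) ^ 2 = (∫⁻ x, ∫⁻ y, f (x, y) ∂κ x ∂m) ^ 2 := by
        rw [Measure.lintegral_compProd hf]
    _ ≤ c * ∫⁻ x, (∫⁻ y, f (x, y) ∂κ x) ^ 2 ∂n := h _ hf.lintegral_kernel_prod_right'
    _ ≤ c * ∫⁻ x, c' * ∫⁻ y, f (x, y) ^ 2 ∂η x ∂n := by
        gcongr with x
        exact h' x _ (hf.comp measurable_prodMk_left)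
    _ = c * c' * ∫⁻ z, f z ^ 2 ∂(n ⊗ₘ η) := by
        rw [Measure.lintegral_compProd (hf.pow_const 2),
          lintegral_const_mul _ (hf.pow_const 2).lintegral_kernel_prod_right', mul_assoc]

theorem sq_measure_le (h : ChiSqBound m n c) {A : Set α} (hA : MeasurableSet A) :
    m A ^ 2 ≤ c * n A := by
  have indicator_sq (x : α) : A.indicator (1 : α → ℝ≥0∞) x ^ 2 = A.indicator 1 x := by
    by_cases hx : x ∈ A <;> simp [hx]
  simpa only [indicator_sq, lintegral_indicator_one hA] using
    h (A.indicator 1) (measurable_one.indicator hA)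

theorem one_sub_div_four_le_real_add_real_compl [IsProbabilityMeasure m] [IsFiniteMeasure n]
    {c : ℝ≥0} (h : ChiSqBound m n c) {A : Set α} (hA : MeasurableSet A) :
    1 - (c : ℝ) / 4 ≤ n.real A + m.real Aᶜ := by
  have hsq : m.real A ^ 2 ≤ c * n.real A := by
    simpa [measureReal_def] using ENNReal.toReal_mono (by finiteness) (h.sq_measure_le hA)
  rw [probReal_compl_eq_one_sub hA]
  rcases eq_or_ne c 0 with rfl | hc
  · have : m.real A = 0 := by simpa using hsq
    simp [this]
  · have hc : (0 : ℝ) < c := by positivity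
    refine le_of_mul_le_mul_left ?_ hc
    nlinarith [sq_nonneg (m.real A - c / 2)]

end ChiSqBound

theorem gaussianReal_eq_withDensity_gaussianReal (a b : ℝ) {v : ℝ≥0} (hv : v ≠ 0) :
    gaussianReal a v = (gaussianReal b v).withDensity
      fun x => ENNReal.ofReal (Real.exp ((a - b) / v * x + (b ^ 2 - a ^ 2) / (2 * v))) := by
  rw [gaussianReal_of_var_ne_zero a hv, gaussianReal_of_var_ne_zero b hv,
    ← withDensity_mul _ (measurable_gaussianPDF b v) (by fun_prop)]
  congr 1 with x
  simp only [gaussianPDF, gaussianPDFReal, Pi.mul_apply]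
  rw [← ENNReal.ofReal_mul (by positivity), mul_assoc _ (Real.exp _), ← Real.exp_add]
  congr 3
  field

theorem chiSqBound_gaussianReal (a b : ℝ) {v : ℝ≥0} (hv : v ≠ 0) :
    ChiSqBound (gaussianReal a v) (gaussianReal b v)
      (ENNReal.ofReal (Real.exp ((a - b) ^ 2 / v))) := by
  have mgf_eq : ∫⁻ x, ENNReal.ofReal (Real.exp (2 * (a - b) / v * x)) ∂gaussianReal b v =
      ENNReal.ofReal (Real.exp (b * (2 * (a - b) / v) + v * (2 * (a - b) / v) ^ 2 / 2)) := by
    rw [← ofReal_integral_eq_lintegral_ofReal (integrable_exp_mul_gaussianReal _)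
      (ae_of_all _ fun x => (Real.exp_pos _).le)]
    exact congrArg ENNReal.ofReal (congrFun mgf_fun_id_gaussianReal _)
  have density_sq (x : ℝ) :
      ENNReal.ofReal (Real.exp ((a - b) / v * x + (b ^ 2 - a ^ 2) / (2 * v))) ^ 2 =
        ENNReal.ofReal (Real.exp ((b ^ 2 - a ^ 2) / v)) *
          ENNReal.ofReal (Real.exp (2 * (a - b) / v * x)) := by
    rw [← ENNReal.ofReal_pow (by positivity), ← ENNReal.ofReal_mul (by positivity),
      ← Real.exp_nat_mul, ← Real.exp_add]
    congr 2
    push_cast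
    field
  have lintegral_density_sq :
      ∫⁻ x, ENNReal.ofReal (Real.exp ((a - b) / v * x + (b ^ 2 - a ^ 2) / (2 * v))) ^ 2
        ∂gaussianReal b v = ENNReal.ofReal (Real.exp ((a - b) ^ 2 / v)) := by
    simp_rw [density_sq]
    rw [lintegral_const_mul _ (by fun_prop), mgf_eq, ← ENNReal.ofReal_mul (by positivity),
      ← Real.exp_add]
    congr 2
    field
  rw [gaussianReal_eq_withDensity_gaussianReal a b hv, ← lintegral_density_sq]
  exact ChiSqBound.withDensity _ (by fun_prop)

section Interaction

variable {K : ℕ} (π : Policy K) {μ ν : Means K} {T : ℕ}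

theorem chiSqBound_historyLaw {c : ℕ → ℝ≥0∞}
    (h : ∀ t < T, ∀ k, ChiSqBound (rewardKernel μ t k) (rewardKernel ν t k) (c t)) :
    ChiSqBound (historyLaw π μ T) (historyLaw π ν T) (∏ t ∈ Finset.range T, c t) := by
  induction T with
  | zero => exact ChiSqBound.refl _
  | succ T ih =>
    have step (x : History K T) : ChiSqBound (stepKernel π μ T x) (stepKernel π ν T x) (c T) := by
      simp only [stepKernel, Kernel.compProd_apply_eq_compProd_sectR, Kernel.sectR_prodMkLeft]
      simpa using (ChiSqBound.refl (π.choice T x)).compProd (h T T.lt_succ_self)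
    rw [Finset.prod_range_succ]
    exact ((ih fun t ht => h t (ht.trans T.lt_succ_self)).compProd step).map measurable_appendRound

theorem chiSqBound_historyLaw_exp_sum {d : ℕ → ℝ} (h : ∀ t < T, ∀ k, |μ k t - ν k t| ≤ d t) :
    ChiSqBound (historyLaw π μ T) (historyLaw π ν T)
      (ENNReal.ofReal (Real.exp (∑ t ∈ Finset.range T, d t ^ 2))) := by
  rw [Real.exp_sum, ENNReal.ofReal_prod_of_nonneg fun _ _ => (Real.exp_pos _).le]
  refine chiSqBound_historyLaw π fun t ht k => ?_
  refine (chiSqBound_gaussianReal (μ k t) (ν k t) one_ne_zero).mono ?_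
  gcongr
  simpa using sq_le_sq.2 ((h t ht k).trans (le_abs_self _))

end Interaction

section Regret

variable {K T : ℕ}

theorem measurable_arm (t : Fin T) : Measurable fun h : History K T => (h t).1 :=
  measurable_fst.comp (measurable_pi_apply t)

theorem le_iSup_mean (μ : Means K) (k : Fin K) (t : ℕ) : μ k t ≤ ⨆ j, μ j t :=
  le_ciSup (Set.finite_range fun j => μ j t).bddAbove k

theorem integrable_pseudoRegret (π : Policy K) (μ : Means K) :
    Integrable (pseudoRegret μ) (historyLaw π μ T) := by
  refine integrable_finsetSum _ fun t _ => (integrable_const _).sub ?_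
  have := Measure.isProbabilityMeasure_map (μ := historyLaw π μ T) (measurable_arm t).aemeasurable
  exact (Integrable.of_finite (f := fun k => μ k t)).comp_measurable (measurable_arm t)

theorem pseudoRegret_le {μ : Means K} (hμ : ∀ k t, μ k t ∈ Set.Icc (0 : ℝ) 1) (h : History K T) :
    pseudoRegret μ h ≤ T := by
  have gap_le_one (t : Fin T) : (⨆ k, μ k t) - μ (h t).1 t ≤ 1 := by
    have : Nonempty (Fin K) := ⟨(h t).1⟩
    linarith [ciSup_le fun k => (hμ k t).2, (hμ (h t).1 t).1]
  simpa [pseudoRegret] using Finset.sum_le_sum fun t (_ : t ∈ Finset.univ) => gap_le_one t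

theorem expectedRegret_le_worstCaseRegret (π : Policy K) {τ : Fin K → ℕ} {μ : Means K}
    (hμ : μ ∈ periodicClass τ) : expectedRegret π μ T ≤ worstCaseRegret π τ T := by
  refine le_ciSup (f := fun ν : periodicClass τ => expectedRegret π ν.1 T) ⟨T, ?_⟩ ⟨μ, hμ⟩
  rintro _ ⟨ν, rfl⟩
  simpa [expectedRegret] using integral_mono (integrable_pseudoRegret π ν.1)
    (integrable_const (T : ℝ)) (pseudoRegret_le ν.2.1)

theorem mul_sum_real_le_expectedRegret (π : Policy K) {μ : Means K} {c : ℝ}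
    {B : Fin T → Set (Fin K)} (hB : ∀ t, ∀ k ∈ B t, c ≤ (⨆ j, μ j t) - μ k t) :
    c * ∑ t, (historyLaw π μ T).real {h | (h t).1 ∈ B t} ≤ expectedRegret π μ T := by
  have hmeas (t : Fin T) : MeasurableSet {h : History K T | (h t).1 ∈ B t} :=
    measurable_arm t .of_discrete
  have hint (t : Fin T) : Integrable
      ({h : History K T | (h t).1 ∈ B t}.indicator fun _ => c) (historyLaw π μ T) :=
    (integrable_const c).indicator (hmeas t)
  calc c * ∑ t, (historyLaw π μ T).real {h | (h t).1 ∈ B t}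
      = ∫ h, ∑ t, {h : History K T | (h t).1 ∈ B t}.indicator (fun _ => c) h
          ∂historyLaw π μ T := by
        rw [integral_finsetSum _ fun t _ => hint t, Finset.mul_sum]
        simp only [integral_indicator_const c (hmeas _), smul_eq_mul, mul_comm c]
    _ ≤ expectedRegret π μ T := by
        refine integral_mono (integrable_finsetSum _ fun t _ => hint t)
          (integrable_pseudoRegret π μ) fun h => Finset.sum_le_sum fun t _ => ?_
        exact Set.indicator_apply_le' (hB t _) fun _ => sub_nonneg.2 (le_iSup_mean μ _ t)

end Regret

section HardInstances

variable {K : ℕ} (τ : Fin K → ℕ) (k₀ : Fin K) (Δ : ℝ) (S : Finset (ZMod (τ k₀)))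

/-- The hard instances: arm `k₀` is better than the others by about `Δ` in the phases belonging to
`S` and worse by about `Δ` in the other phases, a phase being a residue class modulo the period of
`k₀`. The bump of height `Δ / 2` at the multiples of the period makes the minimum periods exact. -/
noncomputable def hardMeans : Means K := fun k t =>
  1 / 2 + (if τ k ∣ t then Δ / 2 else 0) +
    if k = k₀ then (if (t : ZMod (τ k₀)) ∈ S then Δ else -Δ) else 0

/-- The arms that are a wrong choice at epoch `t` on the instance `hardMeans τ k₀ Δ S`. -/
def wrongArms (t : ℕ) : Set (Fin K) :=
  {k | k = k₀ ↔ (t : ZMod (τ k₀)) ∉ S}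

variable {τ k₀ Δ} {S}

theorem hardMeans_mem_periodicClass (hτ : ∀ k, 1 ≤ τ k) (h0 : 0 < Δ) (h1 : Δ ≤ 1 / 3) :
    hardMeans τ k₀ Δ S ∈ periodicClass τ := by
  refine ⟨fun k t => ?_, fun k => ⟨⟨hτ k, fun t => ?_⟩, fun q ⟨hq, hperiod⟩ => ?_⟩⟩
  · unfold hardMeans
    constructor <;> split_ifs <;> linarith
  · by_cases hk : k = k₀
    · subst hk
      simp [hardMeans]
    · simp [hardMeans, hk]
  · by_contra hlt
    have hq_dvd : ¬ τ k ∣ q := fun hd => hlt (Nat.le_of_dvd hq hd)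
    have hbump := hperiod 0
    simp only [hardMeans, zero_add, hq_dvd, if_false, dvd_zero, if_true] at hbump
    split_ifs at hbump <;> linarith

theorem exists_notMem_wrongArms (hK : 2 ≤ K) (t : ℕ) : ∃ k, k ∉ wrongArms τ k₀ S t := by
  have : Nontrivial (Fin K) := Fin.nontrivial_iff_two_le.2 hK
  by_cases ht : (t : ZMod (τ k₀)) ∈ S
  · exact ⟨k₀, by simp [wrongArms, ht]⟩
  · obtain ⟨k, hk⟩ := exists_ne k₀
    exact ⟨k, by simp [wrongArms, ht, hk]⟩

theorem half_le_hardMeans_sub_of_mem_wrongArms (hΔ : 0 ≤ Δ) {t : ℕ} {j k : Fin K}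
    (hj : j ∉ wrongArms τ k₀ S t) (hk : k ∈ wrongArms τ k₀ S t) :
    Δ / 2 ≤ hardMeans τ k₀ Δ S j t - hardMeans τ k₀ Δ S k t := by
  simp only [wrongArms, Set.mem_ofPred_eq] at hj hk
  unfold hardMeans
  split_ifs <;> first | linarith | (exfalso; tauto)

theorem half_le_iSup_hardMeans_sub (hK : 2 ≤ K) (hΔ : 0 ≤ Δ) (t : ℕ) {k : Fin K}
    (hk : k ∈ wrongArms τ k₀ S t) :
    Δ / 2 ≤ (⨆ j, hardMeans τ k₀ Δ S j t) - hardMeans τ k₀ Δ S k t := by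
  obtain ⟨j, hj⟩ := exists_notMem_wrongArms (τ := τ) (k₀ := k₀) (S := S) hK t
  linarith [half_le_hardMeans_sub_of_mem_wrongArms hΔ hj hk,
    le_iSup_mean (hardMeans τ k₀ Δ S) j t]

theorem wrongArms_symmDiff (t : ℕ) :
    wrongArms τ k₀ (S ∆ {(t : ZMod (τ k₀))}) t = (wrongArms τ k₀ S t)ᶜ := by
  ext k
  simp only [wrongArms, Set.mem_ofPred_eq, Set.mem_compl_iff, Finset.mem_symmDiff,
    Finset.mem_singleton]
  tauto

theorem abs_hardMeans_symmDiff_sub_le (hΔ : 0 ≤ Δ) (r : ZMod (τ k₀)) (k : Fin K) (t : ℕ) :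
    |hardMeans τ k₀ Δ (S ∆ {r}) k t - hardMeans τ k₀ Δ S k t| ≤
      if (t : ZMod (τ k₀)) = r then 2 * Δ else 0 := by
  simp only [hardMeans, Finset.mem_symmDiff, Finset.mem_singleton, add_sub_add_left_eq_sub]
  split_ifs <;> first | (exfalso; tauto) | (rw [abs_le]; constructor <;> linarith)

end HardInstances

section LowerBound

variable {K T : ℕ} {τ : Fin K → ℕ} {k₀ : Fin K} {Δ : ℝ}

theorem chiSqBound_historyLaw_hardMeans [NeZero (τ k₀)] (π : Policy K) (hΔ : 0 ≤ Δ)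
    (S : Finset (ZMod (τ k₀))) (r : ZMod (τ k₀)) :
    ChiSqBound (historyLaw π (hardMeans τ k₀ Δ (S ∆ {r})) T) (historyLaw π (hardMeans τ k₀ Δ S) T)
      (ENNReal.ofReal (Real.exp ((T / τ k₀ + 1 : ℕ) * (2 * Δ) ^ 2))) := by
  refine (chiSqBound_historyLaw_exp_sum π fun t _ k =>
    abs_hardMeans_symmDiff_sub_le hΔ r k t).mono ?_
  simp only [ite_pow, zero_pow two_ne_zero, ← Finset.sum_filter, Finset.sum_const, nsmul_eq_mul]
  gcongr
  exact card_filter_natCast_eq_le (τ k₀) T r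

theorem half_le_real_wrongArms_add_real_wrongArms_symmDiff [NeZero (τ k₀)] (π : Policy K)
    (h0 : 0 ≤ Δ) (hΔ : (T / τ k₀ + 1 : ℕ) * (2 * Δ) ^ 2 ≤ Real.log 2)
    (S : Finset (ZMod (τ k₀))) (t : Fin T) :
    1 / 2 ≤ (historyLaw π (hardMeans τ k₀ Δ S) T).real {h | (h t).1 ∈ wrongArms τ k₀ S t} +
      (historyLaw π (hardMeans τ k₀ Δ (S ∆ {(t : ZMod (τ k₀))})) T).real
        {h | (h t).1 ∈ wrongArms τ k₀ (S ∆ {(t : ZMod (τ k₀))}) t} := by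
  have hbound : ENNReal.ofReal (Real.exp ((T / τ k₀ + 1 : ℕ) * (2 * Δ) ^ 2)) ≤ (2 : ℝ≥0) := by
    simpa using (Real.le_log_iff_exp_le two_pos).1 hΔ
  have htest := ((chiSqBound_historyLaw_hardMeans π h0 S (t : ZMod (τ k₀))).mono
    hbound).one_sub_div_four_le_real_add_real_compl
      (measurable_arm t (.of_discrete (s := wrongArms τ k₀ S t)))
  rw [wrongArms_symmDiff]
  calc (1 / 2 : ℝ) = 1 - ((2 : ℝ≥0) : ℝ) / 4 := by norm_num
    _ ≤ _ := htest

theorem mul_div_eight_le_worstCaseRegret (hK : 2 ≤ K) (hτ : ∀ k, 1 ≤ τ k) (π : Policy K)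
    (h0 : 0 < Δ) (h1 : Δ ≤ 1 / 3) (hΔ : (T / τ k₀ + 1 : ℕ) * (2 * Δ) ^ 2 ≤ Real.log 2) :
    Δ * T / 8 ≤ worstCaseRegret π τ T := by
  have : NeZero (τ k₀) := ⟨Nat.one_le_iff_ne_zero.1 (hτ k₀)⟩
  obtain ⟨S, hS⟩ := exists_card_mul_le_sum_of_perm
    (fun t : Fin T => (symmDiff_left_involutive {((t : ℕ) : ZMod (τ k₀))}).toPerm)
    (half_le_real_wrongArms_add_real_wrongArms_symmDiff π h0.le hΔ)
  rw [Fintype.card_fin] at hS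
  calc Δ * T / 8 = Δ / 2 * (T * (1 / 2 / 2)) := by ring
    _ ≤ Δ / 2 * ∑ t : Fin T,
          (historyLaw π (hardMeans τ k₀ Δ S) T).real {h | (h t).1 ∈ wrongArms τ k₀ S t} := by
        gcongr
    _ ≤ expectedRegret π (hardMeans τ k₀ Δ S) T :=
        mul_sum_real_le_expectedRegret π fun t _ => half_le_iSup_hardMeans_sub hK h0.le t
    _ ≤ worstCaseRegret π τ T :=
        expectedRegret_le_worstCaseRegret π (hardMeans_mem_periodicClass hτ h0 h1)

theorem sqrt_mul_period_le_worstCaseRegret (hK : 2 ≤ K) (hτ : ∀ k, 1 ≤ τ k) (π : Policy K)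
    (hT : τ k₀ ≤ T) : Real.sqrt (T * τ k₀) / 64 ≤ worstCaseRegret π τ T := by
  have hp : (0 : ℝ) < τ k₀ := by exact_mod_cast hτ k₀
  have hpT : (τ k₀ : ℝ) ≤ T := by exact_mod_cast hT
  have hT0 : (0 : ℝ) < T := hp.trans_le hpT
  have hcount : ((T / τ k₀ + 1 : ℕ) : ℝ) ≤ 2 * T / τ k₀ := by
    rw [le_div_iff₀ hp]
    push_cast
    linarith [(le_div_iff₀ hp).1 (Nat.cast_div_le (α := ℝ) (m := T) (n := τ k₀))]
  have hsqrt : Real.sqrt (T * τ k₀) ≤ T := Real.sqrt_le_iff.2 ⟨hT0.le, by nlinarith⟩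
  -- Up to the constant, `√(τ k₀ / T)` is the largest gap that stays undetected.
  set Δ := Real.sqrt (T * τ k₀) / (8 * T) with hΔ
  have hΔ_pos : 0 < Δ := by positivity
  have hΔ_le : Δ ≤ 1 / 3 := by
    rw [hΔ, div_le_iff₀ (by positivity)]
    linarith
  have hΔ_sq : Δ ^ 2 = τ k₀ / (64 * T) := by
    rw [hΔ, div_pow, Real.sq_sqrt (by positivity)]
    field
  have hundetected : (T / τ k₀ + 1 : ℕ) * (2 * Δ) ^ 2 ≤ Real.log 2 :=
    calc ((T / τ k₀ + 1 : ℕ) : ℝ) * (2 * Δ) ^ 2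
        = (T / τ k₀ + 1 : ℕ) * (4 * (τ k₀ / (64 * T))) := by rw [mul_pow, hΔ_sq]; norm_num
      _ ≤ 2 * T / τ k₀ * (4 * (τ k₀ / (64 * T))) := by gcongr
      _ = 1 / 8 := by field
      _ ≤ Real.log 2 := by linarith [Real.log_two_gt_d9]
  calc Real.sqrt (T * τ k₀) / 64 = Δ * T / 8 := by rw [hΔ]; field
    _ ≤ worstCaseRegret π τ T := mul_div_eight_le_worstCaseRegret hK hτ π hΔ_pos hΔ_le hundetected

end LowerBound

end PeriodicBandit

theorem theorem3 (K T : ℕ) (hK : 2 ≤ K) (τ : Fin K → ℕ) (hτ : ∀ k, 1 ≤ τ k)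
    (hT : ∀ k, τ k ≤ T) (π : PeriodicBandit.Policy K) :
    1 / (32 * Real.exp 1) * Real.sqrt ((T : ℝ) * (Finset.univ.sup τ : ℕ))
        ≤ PeriodicBandit.worstCaseRegret π τ T ∧
      1 / (32 * Real.exp 1) * (Real.sqrt ((T : ℝ) * ∑ k, (τ k : ℝ)) / Real.sqrt K)
        ≤ PeriodicBandit.worstCaseRegret π τ T := by
  have : Nonempty (Fin K) := ⟨⟨0, by omega⟩⟩
  obtain ⟨k₀, -, hk₀⟩ := Finset.exists_mem_eq_sup Finset.univ Finset.univ_nonempty τ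
  have hconst : 1 / (32 * Real.exp 1) ≤ 1 / 64 := by
    gcongr
    linarith [Real.add_one_le_exp (1 : ℝ)]
  have hmax : 1 / (32 * Real.exp 1) * Real.sqrt ((T : ℝ) * (Finset.univ.sup τ : ℕ)) ≤
      PeriodicBandit.worstCaseRegret π τ T :=
    calc _ ≤ 1 / 64 * Real.sqrt ((T : ℝ) * (Finset.univ.sup τ : ℕ)) := by gcongr
      _ = Real.sqrt (T * τ k₀) / 64 := by rw [hk₀]; ring
      _ ≤ _ := PeriodicBandit.sqrt_mul_period_le_worstCaseRegret hK hτ π (hT k₀)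
  refine ⟨hmax, le_trans ?_ hmax⟩
  gcongr
  simpa using PeriodicBandit.sqrt_mul_sum_div_sqrt_card_le_sqrt_mul_sup τ (Nat.cast_nonneg' T)
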